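/- Consider a bandit with $n\ge 1$ arms and time slots $t=1,2,\dots$. In slot $t$ there is a random set $A_t$ of active arms and a predictor gives a random set $\mathcal K_t\supseteq A_t$ of candidate arms, together with predicted activity probabilities $P_i(t)\in[0,1]$. If the arm $i$ is played in slot $t$ and is active, it yields the reward $\theta_i(t)\in[0,1]$; an inactive arm yields $0$. The rewards $\theta_i(t)$ have mean $\mu_i$ and each of them is independent of everything that happened before slot $t$ and of the predictions and activities up to and including slot $t$. Let $P_i\in(0,1]$ be the average predicted probability of the arm $i$ as a candidate, that is $\mathbb E[P_i(t)\mathbf 1_{i\in\mathcal K_t}]=P_i\,\mathbb P(i\in\mathcal K_t)$ for all $t$, and let $P_{\rm av}=\frac1n\sum_iP_i$. The arms are numbered such that $\mu_1>\dots>\mu_n$, and it is assumed that also $P_1\mu_1>\dots>P_n\mu_n$. Probabilistic sleeping UCB algorithm with parameter $\psi$: let $n'_i(t)$ be the number of earlier slots in which the arm $i$ was played and was active, $z_i(t)$ the sum of the rewards observed in them, $t'=\sum_i n'_i(t)$, and $U_i(t)=\frac{z_i(t)}{n'_i(t)}+\sqrt{\frac{\psi\ln t'}{n'_i(t)}}$.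 In slot $t$, if some $j\in\mathcal K_t$ has $n'_j(t)=0$, such an arm is played (exploration slot); otherwise an arm $x(t)\in\mathcal K_t$ that maximizes $P_i(t)\,U_i(t)$ over $i\in\mathcal K_t$ is played. Ties are broken arbitrarily. If $\mathcal K_t=\emptyset$, nothing is gained or lost. The regret $R(T)$ is the expected sum over $t\le T$ of the reward of the optimal arm of slot $t$ (the active arm of largest mean; $0$ if no arm is active) minus the reward received. Let $f(e_1)$ and $f(e_2)$ be the expected fractions of the slots $t\le T$ in which the following prediction error events occur. * $e_1$: slot $t$ is not an exploration slot, the optimal arm $i$ is active, an active arm $j$ with $\mu_j<\mu_i$ is played, and the predictions of the slot are responsible: $P_iU_i(t)>P_jU_j(t)$, but $P_i(t)U_i(t)\le P_j(t)U_j(t)$. * $e_2$: a non-active arm is played although some arm is active. Theorem. Let $\psi>\frac12$. There is a constant $C$ that depends only on $n$, $\psi$ and $P_1,\dots,P_n$ such that, in every such bandit and for every $T\ge1$, the regret of the algorithm satisfies $$R(T)\le\bigl(4\psi\ln(TP_{\rm av})+C+f(e_1)T\bigr)\sum_{j=2}^{n}\sum_{i=1}^{j-1}\frac{\mu_i-\mu_{i+1}}{(P_i\mu_i-P_j\mu_j)^2}+\mu_1f(e_2)T$$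 and $$R(T)\le\bigl(8\psi\ln(TP_{\rm av})+C+f(e_1)T\bigr)\sum_{j=1}^{n-1}\frac1{(P_{j+1}\mu_{j+1}-P_j\mu_j)^2}+\mu_1f(e_2)T .$$ -/

import Mathlib

open MeasureTheory ProbabilityTheory

noncomputable section

/-- A sleeping bandit with `m + 1` arms, stochastic rewards and a predictor of the active arms.
Time slots are `0, 1, 2, …`. The vector `p` contains the average predicted activity probabilities
and `μ` the expected rewards of the arms. -/
structure SleepingBandit {m : ℕ} (p μ : Fin (m + 1) → ℝ) {Ω : Type*} [mΩ : MeasurableSpace Ω]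
    (Pr : Measure Ω) where
  /-- `hist t` contains everything that happened before slot `t`, and the predictions and
  activities (but not the rewards) of slot `t`. -/
  hist : Filtration ℕ mΩ
  /-- `reward t i`: the reward that arm `i` yields in slot `t` if it is played and is active. -/
  reward : ℕ → Fin (m + 1) → Ω → ℝ
  /-- `pred t i`: the predicted probability that arm `i` is active in slot `t`. -/
  pred : ℕ → Fin (m + 1) → Ω → ℝ
  /-- The arms that the predictor proposes as candidates in slot `t`. -/
  cand : ℕ → Ω → Finset (Fin (m + 1))
  /-- The arms that are really active in slot `t`. -/
  active : ℕ → Ω → Finset (Fin (m + 1))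
  reward_mem : ∀ t i ω, reward t i ω ∈ Set.Icc (0 : ℝ) 1
  pred_mem : ∀ t i ω, pred t i ω ∈ Set.Icc (0 : ℝ) 1
  /-- Every active arm is a candidate, possibly with a small predicted probability;
  a candidate need not be active. -/
  active_subset : ∀ t ω, active t ω ⊆ cand t ω
  reward_measurable : ∀ s t i, s < t → Measurable[hist t] (reward s i)
  pred_measurable : ∀ t i, Measurable[hist t] (pred t i)
  cand_measurable : ∀ t i, MeasurableSet[hist t] {ω | i ∈ cand t ω}
  active_measurable : ∀ t i, MeasurableSet[hist t] {ω | i ∈ active t ω}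
  reward_indep : ∀ t i, Indep (MeasurableSpace.comap (reward t i) inferInstance) (hist t) Pr
  reward_mean : ∀ t i, ∫ ω, reward t i ω ∂Pr = μ i
  /-- The average predicted probability of a candidate arm `i` is `p i`. -/
  pred_mean : ∀ t i,
    ∫ ω in {ω | i ∈ cand t ω}, pred t i ω ∂Pr = p i * Pr.real {ω | i ∈ cand t ω}

namespace SleepingBandit

variable {m : ℕ} {p μ : Fin (m + 1) → ℝ} {Ω : Type*} [mΩ : MeasurableSpace Ω] {Pr : Measure Ω}

/-- Number of slots before `t` in which arm `k` was played and was active. -/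
def plays (B : SleepingBandit p μ Pr) (x : ℕ → Ω → Fin (m + 1)) (k : Fin (m + 1)) (t : ℕ)
    (ω : Ω) : ℕ :=
  ((Finset.range t).filter (fun s => x s ω = k ∧ k ∈ B.active s ω)).card

/-- Number of slots before `t` in which the played arm was active. -/
def activePlays (B : SleepingBandit p μ Pr) (x : ℕ → Ω → Fin (m + 1)) (t : ℕ) (ω : Ω) : ℕ :=
  ((Finset.range t).filter (fun s => x s ω ∈ B.active s ω)).card

/-- Sum of the rewards obtained from arm `k` before slot `t`. -/
def rewardSum (B : SleepingBandit p μ Pr) (x : ℕ → Ω → Fin (m + 1)) (k : Fin (m + 1)) (t : ℕ)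
    (ω : Ω) : ℝ :=
  ∑ s ∈ (Finset.range t).filter (fun s => x s ω = k ∧ k ∈ B.active s ω), B.reward s k ω

/-- The upper confidence bound of arm `k` in slot `t`
(used only where `k` has been played while active). -/
def ucb (B : SleepingBandit p μ Pr) (ψ : ℝ) (x : ℕ → Ω → Fin (m + 1)) (k : Fin (m + 1)) (t : ℕ)
    (ω : Ω) : ℝ :=
  B.rewardSum x k t ω / B.plays x k t ω
    + √(ψ * Real.log (B.activePlays x t ω) / B.plays x k t ω)

/-- Some candidate arm has not been observed yet: the slot is used for initial exploration. -/
def Exploring (B : SleepingBandit p μ Pr) (x : ℕ → Ω → Fin (m + 1)) (t : ℕ) (ω : Ω) : Prop :=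
  ∃ k ∈ B.cand t ω, B.plays x k t ω = 0

/-- The arm sequence `x` is produced by the probabilistic sleeping UCB algorithm, with an arbitrary
(possibly random) choice among unobserved candidates and among maximizers. If there is
no candidate, then no arm is active and the value of `x` is irrelevant. -/
structure IsRun (B : SleepingBandit p μ Pr) (ψ : ℝ) (x : ℕ → Ω → Fin (m + 1)) : Prop where
  measurable : ∀ t i, MeasurableSet[B.hist t] {ω | x t ω = i}
  mem_cand : ∀ t ω, (B.cand t ω).Nonempty → x t ω ∈ B.cand t ω
  explore : ∀ t ω, B.Exploring x t ω → B.plays x (x t ω) t ω = 0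
  maximize : ∀ t ω, ¬ B.Exploring x t ω → ∀ k ∈ B.cand t ω,
    B.pred t k ω * B.ucb ψ x k t ω ≤ B.pred t (x t ω) ω * B.ucb ψ x (x t ω) t ω

/-- `i` is the optimal arm of slot `t`: the active arm of largest expected reward. -/
def IsOptimal (B : SleepingBandit p μ Pr) (t : ℕ) (ω : Ω) (i : Fin (m + 1)) : Prop :=
  i ∈ B.active t ω ∧ ∀ k ∈ B.active t ω, μ k ≤ μ i

/-- The reward of the optimal arm in slot `t` (`0` if no arm is active). The arms are supposed to be
numbered by decreasing expected reward, so that this is the active arm of least index. -/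
def optReward (B : SleepingBandit p μ Pr) (t : ℕ) (ω : Ω) : ℝ :=
  if h : (B.active t ω).Nonempty then B.reward t ((B.active t ω).min' h) ω else 0

/-- The reward received in slot `t`: `0` if the played arm is not active. -/
def gain (B : SleepingBandit p μ Pr) (x : ℕ → Ω → Fin (m + 1)) (t : ℕ) (ω : Ω) : ℝ :=
  if x t ω ∈ B.active t ω then B.reward t (x t ω) ω else 0

/-- The expected regret of the arm sequence `x` over `T` slots. -/
def regret (B : SleepingBandit p μ Pr) (x : ℕ → Ω → Fin (m + 1)) (T : ℕ) : ℝ :=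
  ∫ ω, (∑ t ∈ Finset.range T, B.optReward t ω - ∑ t ∈ Finset.range T, B.gain x t ω) ∂Pr

/-- First prediction error event: in slot `t` a suboptimal active arm `j` is scheduled instead
of the optimal active arm `i` because of the predictions of this slot. With the average predicted
probabilities, `i` would be preferred to `j`; those of slot `t` reverse the order. -/
def ErrorOne (B : SleepingBandit p μ Pr) (ψ : ℝ) (x : ℕ → Ω → Fin (m + 1)) (t : ℕ) (ω : Ω) : Prop :=
  ¬ B.Exploring x t ω ∧ x t ω ∈ B.active t ω ∧
    ∃ i, B.IsOptimal t ω i ∧ μ (x t ω) < μ i ∧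
      p (x t ω) * B.ucb ψ x (x t ω) t ω < p i * B.ucb ψ x i t ω ∧
      B.pred t i ω * B.ucb ψ x i t ω ≤ B.pred t (x t ω) ω * B.ucb ψ x (x t ω) t ω

/-- Second prediction error event: in slot `t` a non-active arm is scheduled although some arm
is active. -/
def ErrorTwo (B : SleepingBandit p μ Pr) (x : ℕ → Ω → Fin (m + 1)) (t : ℕ) (ω : Ω) : Prop :=
  x t ω ∉ B.active t ω ∧ (B.active t ω).Nonempty

/-- Expected frequency of the first prediction error event during `T` slots. -/
def freqOne (B : SleepingBandit p μ Pr) (ψ : ℝ) (x : ℕ → Ω → Fin (m + 1)) (T : ℕ) : ℝ :=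
  (∑ t ∈ Finset.range T, Pr.real {ω | B.ErrorOne ψ x t ω}) / T

/-- Expected frequency of the second prediction error event during `T` slots. -/
def freqTwo (B : SleepingBandit p μ Pr) (x : ℕ → Ω → Fin (m + 1)) (T : ℕ) : ℝ :=
  (∑ t ∈ Finset.range T, Pr.real {ω | B.ErrorTwo x t ω}) / T

end SleepingBandit

/-- The average of the mean predicted activity probabilities of the arms. -/
def avgProb {m : ℕ} (p : Fin (m + 1) → ℝ) : ℝ := (∑ i, p i) / (m + 1)

/-- `∑_{j} ∑_{i < j} (μ i - μ (i+1)) / (p i * μ i - p j * μ j)²`; here `i` runs over all arms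
but the last, so that `i.castSucc` is the arm `i` and `i.succ` the next one. -/
def pairSum {m : ℕ} (p μ : Fin (m + 1) → ℝ) : ℝ :=
  ∑ j : Fin (m + 1), ∑ i : Fin m, if i.castSucc < j then
    (μ i.castSucc - μ i.succ) / (p i.castSucc * μ i.castSucc - p j * μ j) ^ 2 else 0

/-- `∑_{j} 1 / (p (j+1) * μ (j+1) - p j * μ j)²`, over all pairs of consecutive arms. -/
def gapSum {m : ℕ} (p μ : Fin (m + 1) → ℝ) : ℝ :=
  ∑ j : Fin m, 1 / (p j.succ * μ j.succ - p j.castSucc * μ j.castSucc) ^ 2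

end

/-!
The regret of a slot in which some arm is active has two sources. If the played arm is not active,
the slot counts for the second prediction error event and costs at most `μ 0` in mean. Otherwise the
active arm `j` is played instead of the optimal arm `o ≤ j`, and the loss `μ o - μ j` telescopes
over consecutive arms, so that the mean regret is at most the sum over pairs `i < j` of
`μ i - μ (i + 1)` times the expected number of plays of `j` while some arm `≤ i` is active
(`SleepingBandit.IsRun.regret_le`). This uses that a reward is independent of the history and of
the predictions, activities and choices of its slot.

Such a play is a first prediction error, or it violates some confidence interval, or `j` has been
observed at most `4ψ log T / (p i * μ i - p j * μ j)²` times
(`SleepingBandit.IsRun.playedBelow_subset`): without an error, the averaged index of `j` is at least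
that of the optimal arm, so the confidence radius of `j` is at least half of the gap. Slots of the
last kind are few because each of them adds an observation of `j`; slots of initial exploration are
among them.

Violated confidence intervals have to be counted for every `ψ > 1/2`, where a union bound over the
number of observations would need `ψ > 1`. Instead, the numbers of observations are divided into
geometric blocks of ratio `ρ²`. In each block one exponential supermartingale
(`SleepingBandit.IsRun.setLIntegral_expWeight_succ_le`), stopped at the slot of the active play
number `a`, bounds the probability of a violation by a multiple of `a ^ (-2ψ (1 - (ρ - 1)²))`. There
are `O(log a)` blocks, and for `ρ` close to `1` the bounds are summable over `a`
(`SleepingBandit.IsRun.sum_measure_exists_deviates_le`). Only slots with an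
active play matter, and each play number belongs to at most one of them.

The second bound follows from the first because `pairSum ≤ gapSum` (`pairSum_le_gapSum`). The
constant absorbs the logarithm of the average probability.
-/

open scoped ENNReal

namespace SleepingBandit

variable {m : ℕ} {p μ : Fin (m + 1) → ℝ} {Ω : Type*} [mΩ : MeasurableSpace Ω] {Pr : Measure Ω}

/-! ### Adaptedness of the statistics of a run -/

section Adapted

variable {B : SleepingBandit p μ Pr} {ψ : ℝ} {x : ℕ → Ω → Fin (m + 1)}

/-- The event that arm `k` is played and is active in slot `t`. -/
def played (B : SleepingBandit p μ Pr) (x : ℕ → Ω → Fin (m + 1)) (k : Fin (m + 1)) (t : ℕ) :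
    Set Ω :=
  {ω | x t ω = k ∧ k ∈ B.active t ω}

theorem IsRun.measurableSet_played (R : B.IsRun ψ x) (k : Fin (m + 1)) (t : ℕ) :
    MeasurableSet[B.hist t] (B.played x k t) :=
  (R.measurable t k).inter (B.active_measurable t k)

theorem setOf_mem_active_eq (B : SleepingBandit p μ Pr) (x : ℕ → Ω → Fin (m + 1)) (t : ℕ) :
    {ω | x t ω ∈ B.active t ω} = ⋃ k, B.played x k t := by
  ext ω
  simp [played]

theorem IsRun.measurableSet_mem_active (R : B.IsRun ψ x) (t : ℕ) :
    MeasurableSet[B.hist t] {ω | x t ω ∈ B.active t ω} := by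
  rw [setOf_mem_active_eq]
  exact MeasurableSet.iUnion fun k => R.measurableSet_played k t

theorem measurable_reward (B : SleepingBandit p μ Pr) (t : ℕ) (k : Fin (m + 1)) :
    Measurable (B.reward t k) :=
  (B.reward_measurable t (t + 1) k t.lt_succ_self).mono (B.hist.le _) le_rfl

theorem plays_succ (B : SleepingBandit p μ Pr) (x : ℕ → Ω → Fin (m + 1)) (k : Fin (m + 1)) (t : ℕ)
    (ω : Ω) [Decidable (ω ∈ B.played x k t)] :
    B.plays x k (t + 1) ω = B.plays x k t ω + if ω ∈ B.played x k t then 1 else 0 := by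
  classical
  simp only [plays, Finset.card_filter, Finset.sum_range_succ, played, Set.mem_ofPred_eq]
  congr

theorem activePlays_succ (B : SleepingBandit p μ Pr) (x : ℕ → Ω → Fin (m + 1)) (t : ℕ) (ω : Ω) :
    B.activePlays x (t + 1) ω =
      B.activePlays x t ω + if x t ω ∈ B.active t ω then 1 else 0 := by
  simp only [activePlays, Finset.card_filter, Finset.sum_range_succ]

theorem rewardSum_succ (B : SleepingBandit p μ Pr) (x : ℕ → Ω → Fin (m + 1)) (k : Fin (m + 1))
    (t : ℕ) (ω : Ω) [Decidable (ω ∈ B.played x k t)] :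
    B.rewardSum x k (t + 1) ω =
      B.rewardSum x k t ω + if ω ∈ B.played x k t then B.reward t k ω else 0 := by
  classical
  simp only [rewardSum, Finset.sum_filter, Finset.sum_range_succ, played, Set.mem_ofPred_eq]
  congr

theorem IsRun.measurable_plays (R : B.IsRun ψ x) (k : Fin (m + 1)) (t : ℕ) :
    Measurable[B.hist t] (B.plays x k t) := by
  classical
  induction t with
  | zero =>
    have : B.plays x k 0 = fun _ => 0 := by ext ω; simp [plays]
    rw [this]; exact measurable_const
  | succ t ih =>
    have : B.plays x k (t + 1) =
        fun ω => B.plays x k t ω + if ω ∈ B.played x k t then 1 else 0 :=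
      funext fun ω => B.plays_succ x k t ω
    have hle := B.hist.mono t.le_succ
    rw [this]
    exact (ih.mono hle le_rfl).add
      (Measurable.ite (hle _ (R.measurableSet_played k t)) measurable_const measurable_const)

theorem IsRun.measurable_activePlays (R : B.IsRun ψ x) (t : ℕ) :
    Measurable[B.hist t] (B.activePlays x t) := by
  induction t with
  | zero =>
    have : B.activePlays x 0 = fun _ => 0 := by ext ω; simp [activePlays]
    rw [this]; exact measurable_const
  | succ t ih =>
    have hle := B.hist.mono t.le_succ
    rw [funext fun ω => B.activePlays_succ x t ω]
    exact (ih.mono hle le_rfl).add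
      (Measurable.ite (hle _ (R.measurableSet_mem_active t)) measurable_const measurable_const)

theorem IsRun.measurable_rewardSum (R : B.IsRun ψ x) (k : Fin (m + 1)) (t : ℕ) :
    Measurable[B.hist t] (B.rewardSum x k t) := by
  classical
  induction t with
  | zero =>
    have : B.rewardSum x k 0 = fun _ => 0 := by ext ω; simp [rewardSum]
    rw [this]; exact measurable_const
  | succ t ih =>
    have : B.rewardSum x k (t + 1) =
        fun ω => B.rewardSum x k t ω + if ω ∈ B.played x k t then B.reward t k ω else 0 :=
      funext fun ω => B.rewardSum_succ x k t ω
    have hle := B.hist.mono t.le_succ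
    rw [this]
    exact (ih.mono hle le_rfl).add
      (Measurable.ite (hle _ (R.measurableSet_played k t))
        (B.reward_measurable t (t + 1) k t.lt_succ_self) measurable_const)

theorem plays_le_activePlays (B : SleepingBandit p μ Pr) (x : ℕ → Ω → Fin (m + 1))
    (k : Fin (m + 1)) (t : ℕ) (ω : Ω) : B.plays x k t ω ≤ B.activePlays x t ω := by
  refine Finset.card_le_card fun s hs => ?_
  simp only [Finset.mem_filter] at hs ⊢
  exact ⟨hs.1, hs.2.1 ▸ hs.2.2⟩

theorem activePlays_le (B : SleepingBandit p μ Pr) (x : ℕ → Ω → Fin (m + 1))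
    (t : ℕ) (ω : Ω) : B.activePlays x t ω ≤ t := by
  simpa [activePlays] using
    Finset.card_filter_le (Finset.range t) (fun s => x s ω ∈ B.active s ω)

theorem activePlays_mono (B : SleepingBandit p μ Pr) (x : ℕ → Ω → Fin (m + 1)) (ω : Ω) :
    Monotone fun t => B.activePlays x t ω :=
  monotone_nat_of_le_succ fun t => by rw [activePlays_succ]; exact Nat.le_add_right _ _

theorem plays_mono (B : SleepingBandit p μ Pr) (x : ℕ → Ω → Fin (m + 1)) (k : Fin (m + 1)) (ω : Ω) :
    Monotone fun t => B.plays x k t ω := by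
  classical
  exact monotone_nat_of_le_succ fun t => by rw [plays_succ]; exact Nat.le_add_right _ _

end Adapted

/-! ### The exponential supermartingale of an adaptively sampled arm -/

section Exponential

variable {B : SleepingBandit p μ Pr} {ψ : ℝ} {x : ℕ → Ω → Fin (m + 1)}

/-- The centred sum of the rewards obtained from arm `k` before slot `t`. -/
noncomputable def deviation (B : SleepingBandit p μ Pr) (x : ℕ → Ω → Fin (m + 1))
    (k : Fin (m + 1)) (t : ℕ) (ω : Ω) : ℝ :=
  B.rewardSum x k t ω - B.plays x k t ω * μ k

/-- The exponential weight `exp (l * S - l² * n / 8)`, where `n` is the number of observations of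
arm `k` before slot `t` and `S` the centred sum of the observed rewards. It is a supermartingale
by Hoeffding's lemma. Values are in `ℝ≥0∞`, so that no integrability has to be checked. -/
noncomputable def expWeight (B : SleepingBandit p μ Pr) (x : ℕ → Ω → Fin (m + 1)) (l : ℝ)
    (k : Fin (m + 1)) (t : ℕ) (ω : Ω) : ℝ≥0∞ :=
  ENNReal.ofReal (Real.exp (l * B.deviation x k t ω - l ^ 2 / 8 * B.plays x k t ω))

theorem IsRun.measurable_deviation (R : B.IsRun ψ x) (k : Fin (m + 1)) (t : ℕ) :
    Measurable[B.hist t] (B.deviation x k t) := by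
  have h : Measurable[B.hist t] fun ω => (B.plays x k t ω : ℝ) :=
    (measurable_from_top (f := fun n : ℕ => (n : ℝ))).comp (R.measurable_plays k t)
  exact (R.measurable_rewardSum k t).sub (h.mul_const _)

theorem IsRun.measurable_expWeight (R : B.IsRun ψ x) (l : ℝ) (k : Fin (m + 1)) (t : ℕ) :
    Measurable[B.hist t] (B.expWeight x l k t) := by
  have h : Measurable[B.hist t] fun ω => (B.plays x k t ω : ℝ) :=
    (measurable_from_top (f := fun n : ℕ => (n : ℝ))).comp (R.measurable_plays k t)
  exact ENNReal.measurable_ofReal.comp (Real.measurable_exp.comp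
    (((R.measurable_deviation k t).const_mul l).sub (h.const_mul (l ^ 2 / 8))))

theorem lintegral_exp_reward_le [IsProbabilityMeasure Pr] (B : SleepingBandit p μ Pr) (l : ℝ)
    (k : Fin (m + 1)) (t : ℕ) :
    ∫⁻ ω, ENNReal.ofReal (Real.exp (l * (B.reward t k ω - μ k) - l ^ 2 / 8)) ∂Pr ≤ 1 := by
  have h := hasSubgaussianMGF_of_mem_Icc (B.measurable_reward t k).aemeasurable
    (ae_of_all Pr (B.reward_mem t k))
  rw [B.reward_mean] at h
  have e : ∀ ω, Real.exp (l * (B.reward t k ω - μ k) - l ^ 2 / 8) =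
      Real.exp (l * (B.reward t k ω - μ k)) * Real.exp (-(l ^ 2 / 8)) := fun ω => by
    rw [← Real.exp_add, sub_eq_add_neg]
  simp_rw [e]
  rw [← ofReal_integral_eq_lintegral_ofReal ((h.integrable_exp_mul l).mul_const _)
    (ae_of_all _ fun ω => by positivity), integral_mul_const]
  refine ENNReal.ofReal_le_one.2 ?_
  have h2 := h.mgf_le l
  rw [mgf] at h2
  calc _ ≤ Real.exp (l ^ 2 / 8) * Real.exp (-(l ^ 2 / 8)) := by
        refine mul_le_mul_of_nonneg_right (h2.trans (le_of_eq ?_)) (by positivity)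
        congr 1
        push_cast
        norm_num
        ring
    _ = 1 := by rw [← Real.exp_add]; simp

theorem expWeight_succ_of_mem (B : SleepingBandit p μ Pr) (x : ℕ → Ω → Fin (m + 1)) (l : ℝ)
    {k : Fin (m + 1)} {t : ℕ} {ω : Ω} (h : ω ∈ B.played x k t) :
    B.expWeight x l k (t + 1) ω = B.expWeight x l k t ω *
      ENNReal.ofReal (Real.exp (l * (B.reward t k ω - μ k) - l ^ 2 / 8)) := by
  classical
  rw [expWeight, expWeight, ← ENNReal.ofReal_mul (Real.exp_nonneg _), ← Real.exp_add,
    deviation, deviation, rewardSum_succ, plays_succ, if_pos h, if_pos h]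
  congr 2
  push_cast
  ring

theorem expWeight_succ_of_notMem (B : SleepingBandit p μ Pr) (x : ℕ → Ω → Fin (m + 1)) (l : ℝ)
    {k : Fin (m + 1)} {t : ℕ} {ω : Ω} (h : ω ∉ B.played x k t) :
    B.expWeight x l k (t + 1) ω = B.expWeight x l k t ω := by
  classical
  rw [expWeight, expWeight, deviation, deviation, rewardSum_succ, plays_succ, if_neg h, if_neg h]
  simp

/-- The supermartingale property, in integrated form: the reward of slot `t` is independent of
`hist t`. -/
theorem IsRun.setLIntegral_expWeight_succ_le [IsProbabilityMeasure Pr] (R : B.IsRun ψ x) (l : ℝ)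
    (k : Fin (m + 1)) (t : ℕ) {Q : Set Ω} (hQ : MeasurableSet[B.hist t] Q) :
    ∫⁻ ω in Q, B.expWeight x l k (t + 1) ω ∂Pr ≤ ∫⁻ ω in Q, B.expWeight x l k t ω ∂Pr := by
  have hP := R.measurableSet_played k t
  have hP' := B.hist.le t _ hP
  rw [← lintegral_inter_add_sdiff _ Q hP', ← lintegral_inter_add_sdiff (B.expWeight x l k t) Q hP']
  gcongr ?_ + ?_
  · have hS := hQ.inter hP
    have hS' := B.hist.le t _ hS
    have hY : Measurable[MeasurableSpace.comap (B.reward t k) inferInstance] fun ω =>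
        ENNReal.ofReal (Real.exp (l * (B.reward t k ω - μ k) - l ^ 2 / 8)) :=
      (ENNReal.measurable_ofReal.comp (Real.measurable_exp.comp
        (((measurable_id.sub_const (μ k)).const_mul l).sub_const (l ^ 2 / 8)))).comp
        (comap_measurable _)
    have key := lintegral_mul_eq_lintegral_mul_lintegral_of_independent_measurableSpace
      (μ := Pr) (B.hist.le t) (B.measurable_reward t k).comap_le (B.reward_indep t k).symm
      ((R.measurable_expWeight l k t).indicator hS) hY
    calc _ = ∫⁻ ω, (Q ∩ B.played x k t).indicator (B.expWeight x l k t) ω *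
          ENNReal.ofReal (Real.exp (l * (B.reward t k ω - μ k) - l ^ 2 / 8)) ∂Pr := by
          rw [← lintegral_indicator hS']
          refine lintegral_congr fun ω => ?_
          by_cases h : ω ∈ Q ∩ B.played x k t
          · rw [Set.indicator_of_mem h, Set.indicator_of_mem h, expWeight_succ_of_mem _ _ _ h.2]
          · rw [Set.indicator_of_notMem h, Set.indicator_of_notMem h, zero_mul]
      _ ≤ (∫⁻ ω, (Q ∩ B.played x k t).indicator (B.expWeight x l k t) ω ∂Pr) * 1 := by
          rw [key]; gcongr; exact B.lintegral_exp_reward_le l k t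
      _ = _ := by rw [mul_one, lintegral_indicator hS']
  · refine (setLIntegral_congr_fun ((B.hist.le t _ hQ).diff hP') fun ω h => ?_).le
    exact expWeight_succ_of_notMem _ _ _ h.2

/-- Optional stopping: if `D 0, D 1, …` are disjoint events and `D t` is known before the rewards
of slot `t`, then the weight at the slot that `D` selects has expectation at most `1`. -/
theorem IsRun.sum_setLIntegral_expWeight_le_one [IsProbabilityMeasure Pr] (R : B.IsRun ψ x) (l : ℝ)
    (k : Fin (m + 1)) {D : ℕ → Set Ω} (hD : ∀ t, MeasurableSet[B.hist t] (D t))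
    (hdisj : Pairwise fun s t => Disjoint (D s) (D t)) (T : ℕ) :
    ∑ t ∈ Finset.range T, ∫⁻ ω in D t, B.expWeight x l k t ω ∂Pr ≤ 1 := by
  -- The invariant also accounts for the event that no `D s` with `s < T` has occurred.
  suffices h : ∑ t ∈ Finset.range T, ∫⁻ ω in D t, B.expWeight x l k t ω ∂Pr +
      ∫⁻ ω in (⋃ s ∈ Finset.range T, D s)ᶜ, B.expWeight x l k T ω ∂Pr ≤ 1 from
    le_self_add.trans h
  induction T with
  | zero => simp [expWeight, deviation, rewardSum, plays]
  | succ T ih =>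
    refine le_trans ?_ ih
    have hQ : MeasurableSet[B.hist T] (⋃ s ∈ Finset.range (T + 1), D s)ᶜ := by
      refine MeasurableSet.compl (Finset.measurableSet_biUnion _ fun s hs => ?_)
      exact B.hist.mono (Nat.lt_succ_iff.1 (Finset.mem_range.1 hs)) _ (hD s)
    rw [Finset.sum_range_succ, add_assoc]
    refine add_le_add le_rfl ?_
    rw [← lintegral_inter_add_sdiff (B.expWeight x l k T) (⋃ s ∈ Finset.range T, D s)ᶜ
      (B.hist.le T _ (hD T))]
    gcongr ?_ + ?_
    · refine lintegral_mono_set fun ω h => ⟨?_, h⟩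
      simp only [Set.mem_compl_iff, Set.mem_iUnion, not_exists, Finset.mem_range]
      exact fun s hs hs' => (hdisj hs.ne).le_bot ⟨hs', h⟩
    · refine (R.setLIntegral_expWeight_succ_le l k T hQ).trans (lintegral_mono_set fun ω h => ?_)
      simp only [Set.mem_compl_iff, Set.mem_iUnion, not_exists, Finset.mem_range] at h
      simp only [Set.mem_sdiff, Set.mem_compl_iff, Set.mem_iUnion, not_exists, Finset.mem_range]
      exact ⟨fun s hs => h s (hs.trans T.lt_succ_self), h T T.lt_succ_self⟩

end Exponential

/-! ### Confidence intervals by peeling -/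

section Peeling

variable {B : SleepingBandit p μ Pr} {ψ : ℝ} {x : ℕ → Ω → Fin (m + 1)}

/-- For `ψ > 1/2`, a ratio `ρ` of the peeling blocks that is so close to `1` that the exponent
`2ψ (1 - (ρ - 1)²)` still exceeds `1`. -/
theorem exists_peeling_ratio (hψ : 1 / 2 < ψ) : ∃ ρ : ℝ, 1 < ρ ∧ 1 < 2 * ψ * (ρ * (2 - ρ)) := by
  have hd : 0 < 2 * ψ - 1 := by linarith
  refine ⟨1 + (2 * ψ - 1) / (4 * ψ), ?_, ?_⟩
  · have : 0 < (2 * ψ - 1) / (4 * ψ) := by positivity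
    linarith
  · have hψ0 : 0 < ψ := by linarith
    have e : 2 * ψ * ((1 + (2 * ψ - 1) / (4 * ψ)) * (2 - (1 + (2 * ψ - 1) / (4 * ψ)))) - 1 =
        (2 * ψ - 1) * (6 * ψ + 1) / (8 * ψ) := by
      field_simp
      ring
    have : 0 < (2 * ψ - 1) * (6 * ψ + 1) / (8 * ψ) := by positivity
    linarith

/-- If the number `n` of observations lies in the block `[ρ^(2b), ρ^(2b+2)]`, then one
exponential weight, that does not depend on `n`, detects every deviation beyond the confidence
radius `√(ψ L n)`. -/
theorem peeling_exponent_le {L ρ n S : ℝ} (hψ : 0 ≤ ψ) (hL : 0 ≤ L) (hρ : 1 < ρ) (b : ℕ)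
    (hn : ρ ^ (2 * b) ≤ n) (hn' : n ≤ ρ ^ (2 * b + 2)) (hS : √(ψ * L * n) ≤ S) :
    2 * ψ * (ρ * (2 - ρ)) * L ≤
      4 * √(ψ * L) / ρ ^ b * S - (4 * √(ψ * L) / ρ ^ b) ^ 2 / 8 * n := by
  have hb : 0 < ρ ^ b := by positivity
  have hn0 : 0 ≤ n := le_trans (by positivity) hn
  obtain ⟨r, hr⟩ : ∃ r, r = √n / ρ ^ b := ⟨_, rfl⟩
  have hsn : √n = r * ρ ^ b := by rw [hr]; field_simp
  have hnr : n = (r * ρ ^ b) ^ 2 := by rw [← hsn, Real.sq_sqrt hn0]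
  have h1 : 1 ≤ r := by
    rw [hr, le_div_iff₀ hb, one_mul]
    exact Real.le_sqrt_of_sq_le (by rwa [← pow_mul, mul_comm b])
  have h2 : r ≤ ρ := by
    rw [hr, div_le_iff₀ hb]
    refine Real.sqrt_le_iff.2 ⟨by positivity, hn'.trans (le_of_eq (by ring))⟩
  have hs : √(ψ * L) ^ 2 = ψ * L := Real.sq_sqrt (by positivity)
  calc 2 * ψ * (ρ * (2 - ρ)) * L = ψ * L * (2 * (ρ * (2 - ρ))) := by ring
    _ ≤ ψ * L * (4 * r - 2 * r ^ 2) := by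
        refine mul_le_mul_of_nonneg_left ?_ (by positivity)
        nlinarith
    _ = 4 * √(ψ * L) / ρ ^ b * √(ψ * L * n) - (4 * √(ψ * L) / ρ ^ b) ^ 2 / 8 * n := by
        rw [Real.sqrt_mul (by positivity : 0 ≤ ψ * L), hsn, hnr, ← hs]
        rw [Real.sqrt_sq (Real.sqrt_nonneg _)]
        field_simp
        ring
    _ ≤ _ := by gcongr

/-- Bound for the probability that the confidence interval of an arm is violated
at the active play number `a`: there are `⌊log a / log (ρ²)⌋ + 1` blocks and two signs. -/
noncomputable def peelingBound (ψ ρ : ℝ) (a : ℕ) : ℝ :=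
  (⌊Real.log a / (2 * Real.log ρ)⌋₊ + 1) *
    (2 * Real.exp (-(2 * ψ * (ρ * (2 - ρ)) * Real.log a)))

theorem peelingBound_nonneg (ψ ρ : ℝ) (a : ℕ) : 0 ≤ peelingBound ψ ρ a := by
  unfold peelingBound; positivity

theorem summable_peelingBound {ρ : ℝ} (hρ : 1 < ρ) (hα : 1 < 2 * ψ * (ρ * (2 - ρ))) :
    Summable (peelingBound ψ ρ) := by
  obtain ⟨α, hα'⟩ : ∃ α, α = 2 * ψ * (ρ * (2 - ρ)) := ⟨_, rfl⟩
  rw [← hα'] at hα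
  have hlog : 0 < Real.log ρ := Real.log_pos hρ
  obtain ⟨ε, hε⟩ : ∃ ε, ε = (α - 1) / 2 := ⟨_, rfl⟩
  have hε0 : 0 < ε := by linarith
  have h1 : Summable fun a : ℕ => (a : ℝ) ^ (-α) := Real.summable_nat_rpow.2 (by linarith)
  have h2 : Summable fun a : ℕ => (a : ℝ) ^ (-α + ε) := Real.summable_nat_rpow.2 (by linarith)
  refine Summable.of_norm_bounded_eventually_nat
    ((h1.mul_left 2).add (h2.mul_left (2 * (1 / (ε * (2 * Real.log ρ)))))) ?_
  filter_upwards [Filter.eventually_ge_atTop 1] with a ha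
  have ha1 : (1 : ℝ) ≤ a := by exact_mod_cast ha
  have ha0 : (0 : ℝ) < a := by linarith
  rw [Real.norm_of_nonneg (peelingBound_nonneg _ _ _), peelingBound, ← hα',
    show Real.exp (-(α * Real.log a)) = (a : ℝ) ^ (-α) by
      rw [Real.rpow_def_of_pos ha0]; congr 1; ring]
  have hp : 0 < (a : ℝ) ^ (-α) := by positivity
  have hfl : (⌊Real.log a / (2 * Real.log ρ)⌋₊ : ℝ) ≤ (a : ℝ) ^ ε / ε / (2 * Real.log ρ) :=
    (Nat.floor_le (div_nonneg (Real.log_nonneg ha1) (by positivity))).trans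
      (div_le_div_of_nonneg_right (Real.log_le_rpow_div ha0.le hε0) (by positivity))
  calc _ ≤ ((a : ℝ) ^ ε / ε / (2 * Real.log ρ) + 1) * (2 * (a : ℝ) ^ (-α)) := by gcongr
    _ = _ := by
      rw [Real.rpow_add ha0]
      field_simp
      ring

/-- The event that the active play number `a` (counted from `0`) takes place in slot `t`. -/
def atPlay (B : SleepingBandit p μ Pr) (x : ℕ → Ω → Fin (m + 1)) (a t : ℕ) : Set Ω :=
  {ω | x t ω ∈ B.active t ω ∧ B.activePlays x t ω = a}

theorem IsRun.measurableSet_atPlay (R : B.IsRun ψ x) (a t : ℕ) :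
    MeasurableSet[B.hist t] (B.atPlay x a t) :=
  (R.measurableSet_mem_active t).inter (R.measurable_activePlays t (measurableSet_singleton a))

theorem disjoint_atPlay (B : SleepingBandit p μ Pr) (x : ℕ → Ω → Fin (m + 1)) (a : ℕ) :
    Pairwise fun s t => Disjoint (B.atPlay x a s) (B.atPlay x a t) := by
  have key : ∀ s t, s < t → Disjoint (B.atPlay x a s) (B.atPlay x a t) := by
    refine fun s t hst => Set.disjoint_left.2 fun ω hs ht => ?_
    have h1 := B.activePlays_succ x s ω
    rw [if_pos hs.1, hs.2] at h1
    have h2 : B.activePlays x (s + 1) ω ≤ B.activePlays x t ω := B.activePlays_mono x ω hst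
    rw [h1, ht.2] at h2
    omega
  intro s t hst
  rcases hst.lt_or_gt with h | h
  · exact key s t h
  · exact (key t s h).symm

/-- Ville's inequality at the slot that contains the active play number `a`. -/
theorem IsRun.sum_measure_expWeight_ge_le [IsProbabilityMeasure Pr] (R : B.IsRun ψ x) (l c : ℝ)
    (k : Fin (m + 1)) (a T : ℕ) :
    ∑ t ∈ Finset.range T,
      Pr ({ω | ENNReal.ofReal (Real.exp c) ≤ B.expWeight x l k t ω} ∩ B.atPlay x a t) ≤
      ENNReal.ofReal (Real.exp (-c)) := by
  have h := R.sum_setLIntegral_expWeight_le_one l k (R.measurableSet_atPlay a)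
    (B.disjoint_atPlay x a) T
  have h2 : ENNReal.ofReal (Real.exp c) * ∑ t ∈ Finset.range T,
      Pr ({ω | ENNReal.ofReal (Real.exp c) ≤ B.expWeight x l k t ω} ∩ B.atPlay x a t) ≤ 1 := by
    rw [Finset.mul_sum]
    refine le_trans (Finset.sum_le_sum fun t _ => ?_) h
    rw [← Measure.restrict_apply' (B.hist.le t _ (R.measurableSet_atPlay a t))]
    exact mul_meas_ge_le_lintegral ((R.measurable_expWeight l k t).mono (B.hist.le t) le_rfl) _
  rw [Real.exp_neg, ENNReal.ofReal_inv_of_pos (Real.exp_pos c)]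
  rw [← one_div, ENNReal.le_div_iff_mul_le (by simp [Real.exp_pos]) (by simp), mul_comm]
  exact h2

/-- The event that arm `k` has been observed and its average observed reward differs from its mean
by more than the confidence radius (everything multiplied by the number of observations). -/
def Deviates (B : SleepingBandit p μ Pr) (ψ : ℝ) (x : ℕ → Ω → Fin (m + 1)) (k : Fin (m + 1))
    (t : ℕ) (ω : Ω) : Prop :=
  1 ≤ B.plays x k t ω ∧
    √(ψ * Real.log (B.activePlays x t ω) * B.plays x k t ω) < |B.deviation x k t ω|

theorem IsRun.sum_measure_deviates_le [IsProbabilityMeasure Pr] (R : B.IsRun ψ x) (hψ : 0 ≤ ψ)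
    {ρ : ℝ} (hρ : 1 < ρ) (k : Fin (m + 1)) (a T : ℕ) :
    ∑ t ∈ Finset.range T, Pr ({ω | B.Deviates ψ x k t ω} ∩ B.atPlay x a t) ≤
      ENNReal.ofReal (peelingBound ψ ρ a) := by
  obtain ⟨c, hc⟩ : ∃ c, c = 2 * ψ * (ρ * (2 - ρ)) * Real.log a := ⟨_, rfl⟩
  obtain ⟨l, hl⟩ : ∃ l : ℕ → ℝ, l = fun b => 4 * √(ψ * Real.log a) / ρ ^ b := ⟨_, rfl⟩
  obtain ⟨N, hN⟩ : ∃ N, N = ⌊Real.log a / (2 * Real.log ρ)⌋₊ + 1 := ⟨_, rfl⟩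
  let E : ℝ → ℕ → Set Ω := fun l t =>
    {ω | ENNReal.ofReal (Real.exp c) ≤ B.expWeight x l k t ω} ∩ B.atPlay x a t
  have hsub : ∀ t, {ω | B.Deviates ψ x k t ω} ∩ B.atPlay x a t ⊆
      ⋃ b ∈ Finset.range N, (E (l b) t ∪ E (-l b) t) := by
    rintro t ω ⟨⟨h1, h2⟩, hD⟩
    rw [hD.2] at h2
    have hn1 : (1 : ℝ) ≤ B.plays x k t ω := by exact_mod_cast h1
    have hna : (B.plays x k t ω : ℝ) ≤ a := by
      exact_mod_cast hD.2 ▸ B.plays_le_activePlays x k t ω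
    have hlog : 0 < Real.log ρ := Real.log_pos hρ
    -- The block of the number of observations; there is one of index below `N` because this number
    -- is at most `a`.
    obtain ⟨b, hb1, hb2⟩ := exists_nat_pow_near hn1 (one_lt_pow₀ hρ two_ne_zero)
    rw [← pow_mul] at hb1 hb2
    have hbN : b < N := by
      rw [hN, Nat.lt_succ_iff]
      refine Nat.le_floor ?_
      rw [le_div_iff₀ (by positivity)]
      have := Real.log_le_log (by positivity) (hb1.trans hna)
      rw [Real.log_pow] at this
      push_cast at this
      linarith
    have hL : 0 ≤ Real.log a := Real.log_nonneg (hn1.trans hna)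
    have key : ∀ S, √(ψ * Real.log a * B.plays x k t ω) ≤ S →
        c ≤ l b * S - l b ^ 2 / 8 * B.plays x k t ω := fun S hS => by
      rw [hc, hl]
      exact peeling_exponent_le hψ hL hρ b hb1 hb2.le hS
    refine Set.mem_biUnion (Finset.mem_coe.2 (Finset.mem_range.2 hbN)) ?_
    -- A deviation downwards is detected by the weight with parameter `-l b`.
    rcases lt_abs.1 h2 with h | h
    · exact Or.inl ⟨ENNReal.ofReal_le_ofReal (Real.exp_le_exp.2 (key _ h.le)), hD⟩
    · refine Or.inr ⟨ENNReal.ofReal_le_ofReal (Real.exp_le_exp.2 ((key _ h.le).trans ?_)), hD⟩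
      exact le_of_eq (by ring)
  calc _ ≤ ∑ t ∈ Finset.range T, ∑ b ∈ Finset.range N, (Pr (E (l b) t) + Pr (E (-l b) t)) :=
        Finset.sum_le_sum fun t _ => (measure_mono (hsub t)).trans
          ((measure_biUnion_finset_le _ _).trans
            (Finset.sum_le_sum fun b _ => measure_union_le _ _))
    _ = ∑ b ∈ Finset.range N, (∑ t ∈ Finset.range T, Pr (E (l b) t) +
          ∑ t ∈ Finset.range T, Pr (E (-l b) t)) := by
        rw [Finset.sum_comm]
        simp_rw [Finset.sum_add_distrib]
    _ ≤ ∑ b ∈ Finset.range N,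
          (ENNReal.ofReal (Real.exp (-c)) + ENNReal.ofReal (Real.exp (-c))) :=
        Finset.sum_le_sum fun b _ => add_le_add (R.sum_measure_expWeight_ge_le _ _ k a T)
          (R.sum_measure_expWeight_ge_le _ _ k a T)
    _ = _ := by
        rw [Finset.sum_const, Finset.card_range, ← ENNReal.ofReal_add (by positivity)
          (by positivity), ← ENNReal.ofReal_nsmul, nsmul_eq_mul, peelingBound, ← hc, hN,
          two_mul (Real.exp (-c))]
        push_cast
        rfl

/-- The expected number of active plays at which some confidence interval is violated is bounded
independently of the horizon. -/
theorem IsRun.sum_measure_exists_deviates_le [IsProbabilityMeasure Pr] (R : B.IsRun ψ x)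
    (hψ : 0 ≤ ψ) {ρ : ℝ} (hρ : 1 < ρ) (hα : 1 < 2 * ψ * (ρ * (2 - ρ))) (T : ℕ) :
    ∑ t ∈ Finset.range T, Pr.real {ω | x t ω ∈ B.active t ω ∧ ∃ k, B.Deviates ψ x k t ω} ≤
      (m + 1) * ∑' a, peelingBound ψ ρ a := by
  have hsub : ∀ t ∈ Finset.range T,
      {ω | x t ω ∈ B.active t ω ∧ ∃ k, B.Deviates ψ x k t ω} ⊆
      ⋃ a ∈ Finset.range T, ⋃ k ∈ Finset.univ, {ω | B.Deviates ψ x k t ω} ∩ B.atPlay x a t := by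
    rintro t ht ω ⟨hx, k, hk⟩
    simp only [Set.mem_iUnion]
    exact ⟨B.activePlays x t ω, Finset.mem_range.2
      ((B.activePlays_le x t ω).trans_lt (Finset.mem_range.1 ht)), k, Finset.mem_univ k,
      hk, hx, rfl⟩
  have h : ∑ t ∈ Finset.range T, Pr {ω | x t ω ∈ B.active t ω ∧ ∃ k, B.Deviates ψ x k t ω} ≤
      ENNReal.ofReal ((m + 1) * ∑' a, peelingBound ψ ρ a) := by
    calc _ ≤ ∑ t ∈ Finset.range T, ∑ a ∈ Finset.range T, ∑ k,
            Pr ({ω | B.Deviates ψ x k t ω} ∩ B.atPlay x a t) :=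
          Finset.sum_le_sum fun t ht => (measure_mono (hsub t ht)).trans
            ((measure_biUnion_finset_le _ _).trans
              (Finset.sum_le_sum fun a _ => measure_biUnion_finset_le _ _))
      _ = ∑ a ∈ Finset.range T, ∑ k, ∑ t ∈ Finset.range T,
            Pr ({ω | B.Deviates ψ x k t ω} ∩ B.atPlay x a t) := by
          rw [Finset.sum_comm]
          exact Finset.sum_congr rfl fun a _ => Finset.sum_comm
      _ ≤ ∑ a ∈ Finset.range T, ∑ _k : Fin (m + 1), ENNReal.ofReal (peelingBound ψ ρ a) :=
          Finset.sum_le_sum fun a _ => Finset.sum_le_sum fun k _ =>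
            R.sum_measure_deviates_le hψ hρ k a T
      _ = ENNReal.ofReal ((m + 1) * ∑ a ∈ Finset.range T, peelingBound ψ ρ a) := by
          simp_rw [Finset.sum_const, Finset.card_univ, Fintype.card_fin, ← ENNReal.ofReal_nsmul]
          rw [← ENNReal.ofReal_sum_of_nonneg fun a _ => nsmul_nonneg (peelingBound_nonneg _ _ _) _,
            ← Finset.smul_sum, nsmul_eq_mul]
          push_cast
          rfl
      _ ≤ _ := by
          gcongr
          exact (summable_peelingBound hρ hα).sum_le_tsum _ fun a _ => peelingBound_nonneg _ _ _
  have h0 : 0 ≤ ∑' a, peelingBound ψ ρ a := tsum_nonneg fun a => peelingBound_nonneg _ _ _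
  simp_rw [measureReal_def]
  rw [← ENNReal.toReal_sum fun t _ => measure_ne_top _ _]
  exact ENNReal.toReal_le_of_le_ofReal (by positivity) h

end Peeling

/-! ### Counting the plays of a suboptimal arm -/

section Counting

variable {B : SleepingBandit p μ Pr} {ψ : ℝ} {x : ℕ → Ω → Fin (m + 1)}

/-- Each active play of `j` increases its number of observations, so at most `b + 1` of them happen
while this number is at most `b`. -/
theorem sum_indicator_played_le (B : SleepingBandit p μ Pr) (x : ℕ → Ω → Fin (m + 1))
    (j : Fin (m + 1)) {b : ℝ} (hb : 0 ≤ b) (T : ℕ) (ω : Ω) :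
    ∑ t ∈ Finset.range T, (B.played x j t ∩ {ω | (B.plays x j t ω : ℝ) ≤ b}).indicator
      (1 : Ω → ℝ) ω ≤ b + 1 := by
  classical
  have hcard : ((Finset.range T).filter
      fun t => ω ∈ B.played x j t ∩ {ω | (B.plays x j t ω : ℝ) ≤ b}).card ≤ ⌊b⌋₊ + 1 := by
    rw [← Finset.card_range (⌊b⌋₊ + 1)]
    have key : ∀ s t, ω ∈ B.played x j s → s < t → B.plays x j s ω < B.plays x j t ω :=
      fun s t hs hst => by
        refine lt_of_lt_of_le ?_ (B.plays_mono x j ω (show s + 1 ≤ t from hst))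
        simp [plays_succ, hs]
    refine Finset.card_le_card_of_injOn (fun t => B.plays x j t ω) (fun t ht => ?_) ?_
    · have h2 : (B.plays x j t ω : ℝ) ≤ b := (Finset.mem_filter.1 ht).2.2
      exact Finset.mem_coe.2 (Finset.mem_range.2 (Nat.lt_succ_of_le (Nat.le_floor h2)))
    · intro s hs t ht hst
      rcases lt_trichotomy s t with h | h | h
      · exact absurd hst (key s t (Finset.mem_filter.1 hs).2.1 h).ne
      · exact h
      · exact absurd hst (key t s (Finset.mem_filter.1 ht).2.1 h).ne'
  simp only [Set.indicator_apply, Pi.one_apply]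
  rw [Finset.sum_boole]
  calc _ ≤ ((⌊b⌋₊ + 1 : ℕ) : ℝ) := by exact_mod_cast hcard
    _ ≤ b + 1 := by push_cast; gcongr; exact Nat.floor_le hb

theorem IsRun.sum_measure_played_le [IsProbabilityMeasure Pr] (R : B.IsRun ψ x)
    (j : Fin (m + 1)) {b : ℝ} (hb : 0 ≤ b) (T : ℕ) :
    ∑ t ∈ Finset.range T, Pr.real (B.played x j t ∩ {ω | (B.plays x j t ω : ℝ) ≤ b}) ≤ b + 1 := by
  have hm : ∀ t, MeasurableSet (B.played x j t ∩ {ω | (B.plays x j t ω : ℝ) ≤ b}) := fun t =>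
    B.hist.le t _ ((R.measurableSet_played j t).inter
      (R.measurable_plays j t (MeasurableSet.of_discrete (s := {n : ℕ | (n : ℝ) ≤ b}))))
  have hi : ∀ t, Integrable ((B.played x j t ∩ {ω | (B.plays x j t ω : ℝ) ≤ b}).indicator
      (1 : Ω → ℝ)) Pr := fun t => (integrable_const (1 : ℝ)).indicator (hm t)
  simp_rw [← integral_indicator_one (hm _)]
  rw [← integral_finsetSum _ fun t _ => hi t]
  calc _ ≤ ∫ _, b + 1 ∂Pr := integral_mono (integrable_finsetSum _ fun t _ => hi t)
        (integrable_const _) fun ω => B.sum_indicator_played_le x j hb T ω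
    _ = b + 1 := by simp

/-- An arm whose confidence interval is valid has an index between its mean and its mean plus twice
the confidence radius. -/
theorem ucb_mem_of_not_deviates (B : SleepingBandit p μ Pr) {k : Fin (m + 1)} {t : ℕ} {ω : Ω}
    (hn : 1 ≤ B.plays x k t ω) (h : ¬ B.Deviates ψ x k t ω) :
    μ k ≤ B.ucb ψ x k t ω ∧
      B.ucb ψ x k t ω ≤ μ k +
        2 * √(ψ * Real.log (B.activePlays x t ω) / B.plays x k t ω) := by
  have h' : |B.deviation x k t ω| ≤
      √(ψ * Real.log (B.activePlays x t ω) * B.plays x k t ω) := not_lt.1 fun h' => h ⟨hn, h'⟩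
  have hn0 : (0 : ℝ) < B.plays x k t ω := by exact_mod_cast hn
  have e : √(ψ * Real.log (B.activePlays x t ω) * B.plays x k t ω) =
      √(ψ * Real.log (B.activePlays x t ω) / B.plays x k t ω) * B.plays x k t ω := by
    rw [← Real.sqrt_sq hn0.le, ← Real.sqrt_mul' _ (sq_nonneg _), Real.sqrt_sq hn0.le]
    congr 1
    field_simp
  rw [e, abs_le, deviation] at h'
  have e2 : B.rewardSum x k t ω =
      B.rewardSum x k t ω / B.plays x k t ω * B.plays x k t ω := by field_simp
  rw [e2] at h'
  constructor
  · rw [ucb]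
    refine le_of_mul_le_mul_right ?_ hn0
    linarith [h'.1]
  · rw [ucb]
    refine le_of_mul_le_mul_right ?_ hn0
    linarith [h'.2]

theorem isOptimal_min' (B : SleepingBandit p μ Pr) (hμ : StrictAnti μ) {t : ℕ} {ω : Ω}
    (h : (B.active t ω).Nonempty) : B.IsOptimal t ω ((B.active t ω).min' h) :=
  ⟨Finset.min'_mem _ _, fun k hk => hμ.antitone (Finset.min'_le _ k hk)⟩

/-- The event that arm `j` is played and is active in slot `t`, while the optimal arm of the slot
has index at most `i`. -/
def playedBelow (B : SleepingBandit p μ Pr) (x : ℕ → Ω → Fin (m + 1)) (i j : Fin (m + 1)) (t : ℕ) :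
    Set Ω :=
  B.played x j t ∩ {ω | ∃ k ≤ i, k ∈ B.active t ω}

theorem IsRun.measurableSet_playedBelow (R : B.IsRun ψ x) (i j : Fin (m + 1)) (t : ℕ) :
    MeasurableSet[B.hist t] (B.playedBelow x i j t) := by
  refine (R.measurableSet_played j t).inter ?_
  have : {ω | ∃ k ≤ i, k ∈ B.active t ω} = ⋃ k ∈ Finset.Iic i, {ω | k ∈ B.active t ω} := by
    ext ω
    simp
  rw [this]
  exact Finset.measurableSet_biUnion _ fun k _ => B.active_measurable t k

/-- If arm `j` is preferred to the better arm `k` although all confidence intervals are valid, then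
`j` has not been observed often: its confidence interval covers the gap of the weighted means. -/
theorem plays_le_of_not_deviates (B : SleepingBandit p μ Pr) (hψ : 0 ≤ ψ)
    (hp : ∀ i, 0 < p i ∧ p i ≤ 1) {k j : Fin (m + 1)} {t : ℕ} {ω : Ω} {g : ℝ} (hg : 0 < g)
    (hgap : g ≤ p k * μ k - p j * μ j)
    (hk1 : 1 ≤ B.plays x k t ω) (hj1 : 1 ≤ B.plays x j t ω)
    (hk : ¬ B.Deviates ψ x k t ω) (hj : ¬ B.Deviates ψ x j t ω)
    (hle : p k * B.ucb ψ x k t ω ≤ p j * B.ucb ψ x j t ω) :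
    (B.plays x j t ω : ℝ) ≤ 4 * ψ * Real.log (B.activePlays x t ω) / g ^ 2 := by
  have hn0 : (0 : ℝ) < B.plays x j t ω := by exact_mod_cast hj1
  obtain ⟨r, hr⟩ : ∃ r, r = √(ψ * Real.log (B.activePlays x t ω) / B.plays x j t ω) := ⟨_, rfl⟩
  have hr0 : 0 ≤ r := hr ▸ Real.sqrt_nonneg _
  have h1 := mul_le_mul_of_nonneg_left (B.ucb_mem_of_not_deviates hk1 hk).1 (hp k).1.le
  have h2 := mul_le_mul_of_nonneg_left (B.ucb_mem_of_not_deviates hj1 hj).2 (hp j).1.le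
  rw [← hr] at h2
  have h3 : p j * (2 * r) ≤ 1 * (2 * r) :=
    mul_le_mul_of_nonneg_right (hp j).2 (by positivity)
  have h4 : g ≤ 2 * r := by linarith
  have hL : 0 ≤ Real.log (B.activePlays x t ω) := Real.log_natCast_nonneg _
  have h5 : r ^ 2 = ψ * Real.log (B.activePlays x t ω) / B.plays x j t ω := by
    rw [hr, Real.sq_sqrt (by positivity)]
  have h6 : g ^ 2 ≤ 4 * (ψ * Real.log (B.activePlays x t ω) / B.plays x j t ω) := by
    rw [← h5]
    nlinarith
  rw [le_div_iff₀ (by positivity)]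
  calc (B.plays x j t ω : ℝ) * g ^ 2 ≤
        B.plays x j t ω * (4 * (ψ * Real.log (B.activePlays x t ω) / B.plays x j t ω)) := by gcongr
    _ = _ := by field_simp

/-- A suboptimal active play is due to a prediction error of the first kind, to a lack of
observations of the played arm, or to a violated confidence interval. -/
theorem IsRun.playedBelow_subset (R : B.IsRun ψ x) (hψ : 0 ≤ ψ) (hp : ∀ i, 0 < p i ∧ p i ≤ 1)
    (hμ : StrictAnti μ) (hpμ : StrictAnti fun i => p i * μ i) {i j : Fin (m + 1)} (hij : i < j)
    {t T : ℕ} (ht : t < T) :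
    B.playedBelow x i j t ⊆ {ω | B.ErrorOne ψ x t ω} ∪
      ((B.played x j t ∩
        {ω | (B.plays x j t ω : ℝ) ≤ 4 * ψ * Real.log T / (p i * μ i - p j * μ j) ^ 2}) ∪
      {ω | x t ω ∈ B.active t ω ∧ ∃ k, B.Deviates ψ x k t ω}) := by
  rintro ω ⟨⟨rfl, hact⟩, k, hki, hk⟩
  by_contra hcon
  simp only [Set.mem_union, not_or] at hcon
  obtain ⟨hE, hlow, hdev⟩ := hcon
  have hlow' : 4 * ψ * Real.log T / (p i * μ i - p (x t ω) * μ (x t ω)) ^ 2 <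
      B.plays x (x t ω) t ω := not_le.1 fun h => hlow ⟨⟨rfl, hact⟩, h⟩
  have hdev' : ∀ k, ¬ B.Deviates ψ x k t ω := fun k hk => hdev ⟨hact, k, hk⟩
  have hlogT : 0 ≤ Real.log T := Real.log_natCast_nonneg _
  -- In an exploration slot the played arm has no observations.
  have hexp : ¬ B.Exploring x t ω := fun h => by
    rw [R.explore t ω h] at hlow'
    exact absurd hlow' (not_lt.2 (by push_cast; positivity))
  have hne : (B.active t ω).Nonempty := ⟨_, hk⟩
  obtain ⟨o, ho⟩ : ∃ o, o = (B.active t ω).min' hne := ⟨_, rfl⟩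
  have hopt : B.IsOptimal t ω o := ho ▸ B.isOptimal_min' hμ hne
  have hoi : o ≤ i := (ho ▸ Finset.min'_le _ k hk).trans hki
  have hpos : ∀ k ∈ B.cand t ω, 1 ≤ B.plays x k t ω := fun k hk =>
    Nat.one_le_iff_ne_zero.2 fun h => hexp ⟨k, hk, h⟩
  have hoc := B.active_subset t ω hopt.1
  have hle : p o * B.ucb ψ x o t ω ≤ p (x t ω) * B.ucb ψ x (x t ω) t ω :=
    not_lt.1 fun h => hE ⟨hexp, hact, o, hopt, hμ (hoi.trans_lt hij), h, R.maximize t ω hexp o hoc⟩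
  have h := B.plays_le_of_not_deviates hψ hp (g := p i * μ i - p (x t ω) * μ (x t ω))
    (sub_pos.2 (hpμ hij)) (sub_le_sub_right (hpμ.antitone hoi) _) (hpos o hoc)
    (hpos _ (B.active_subset t ω hact)) (hdev' o) (hdev' _) hle
  refine absurd (h.trans ?_) (not_le.2 hlow')
  have h1 : (1 : ℝ) ≤ B.activePlays x t ω := by
    exact_mod_cast (hpos o hoc).trans (B.plays_le_activePlays x o t ω)
  have h2 : (B.activePlays x t ω : ℝ) ≤ T := by
    exact_mod_cast (B.activePlays_le x t ω).trans ht.le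
  have := Real.log_le_log (by linarith) h2
  gcongr

theorem integrable_reward [IsFiniteMeasure Pr] (B : SleepingBandit p μ Pr) (t : ℕ)
    (k : Fin (m + 1)) : Integrable (B.reward t k) Pr :=
  Integrable.of_mem_Icc 0 1 (B.measurable_reward t k).aemeasurable (ae_of_all _ (B.reward_mem t k))

theorem mean_mem_Icc [IsProbabilityMeasure Pr] (B : SleepingBandit p μ Pr) (i : Fin (m + 1)) :
    μ i ∈ Set.Icc (0 : ℝ) 1 := by
  rw [← B.reward_mean 0 i]
  refine ⟨integral_nonneg fun ω => (B.reward_mem 0 i ω).1, ?_⟩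
  calc _ ≤ ∫ _, (1 : ℝ) ∂Pr := integral_mono (B.integrable_reward 0 i) (integrable_const _)
        fun ω => (B.reward_mem 0 i ω).2
    _ = 1 := by simp

theorem IsRun.sum_measure_playedBelow_le [IsProbabilityMeasure Pr] (R : B.IsRun ψ x) (hψ : 0 ≤ ψ)
    (hp : ∀ i, 0 < p i ∧ p i ≤ 1) (hμ : StrictAnti μ) (hpμ : StrictAnti fun i => p i * μ i)
    {ρ : ℝ} (hρ : 1 < ρ) (hα : 1 < 2 * ψ * (ρ * (2 - ρ))) {i j : Fin (m + 1)} (hij : i < j)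
    (T : ℕ) :
    ∑ t ∈ Finset.range T, Pr.real (B.playedBelow x i j t) ≤
      (4 * ψ * Real.log T + (1 + (m + 1) * ∑' a, peelingBound ψ ρ a) +
        ∑ t ∈ Finset.range T, Pr.real {ω | B.ErrorOne ψ x t ω}) /
          (p i * μ i - p j * μ j) ^ 2 := by
  have hlogT : 0 ≤ Real.log T := Real.log_natCast_nonneg _
  have h0 : 0 ≤ ∑' a, peelingBound ψ ρ a := tsum_nonneg fun a => peelingBound_nonneg _ _ _
  have hg : 0 < p i * μ i - p j * μ j := sub_pos.2 (hpμ hij)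
  have hg1 : p i * μ i - p j * μ j ≤ 1 := by
    have h1 : p i * μ i ≤ 1 := mul_le_one₀ (hp i).2 (B.mean_mem_Icc i).1 (B.mean_mem_Icc i).2
    have h2 : 0 ≤ p j * μ j := mul_nonneg (hp j).1.le (B.mean_mem_Icc j).1
    linarith
  have hE : 0 ≤ ∑ t ∈ Finset.range T, Pr.real {ω | B.ErrorOne ψ x t ω} :=
    Finset.sum_nonneg fun _ _ => measureReal_nonneg
  calc _ ≤ ∑ t ∈ Finset.range T, (Pr.real {ω | B.ErrorOne ψ x t ω} +
        (Pr.real (B.played x j t ∩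
          {ω | (B.plays x j t ω : ℝ) ≤ 4 * ψ * Real.log T / (p i * μ i - p j * μ j) ^ 2}) +
        Pr.real {ω | x t ω ∈ B.active t ω ∧ ∃ k, B.Deviates ψ x k t ω})) :=
        Finset.sum_le_sum fun t ht => (measureReal_mono (R.playedBelow_subset hψ hp hμ hpμ hij
          (Finset.mem_range.1 ht))).trans ((measureReal_union_le _ _).trans
            (add_le_add le_rfl (measureReal_union_le _ _)))
    _ ≤ ∑ t ∈ Finset.range T, Pr.real {ω | B.ErrorOne ψ x t ω} +
        (4 * ψ * Real.log T / (p i * μ i - p j * μ j) ^ 2 + 1 +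
          (m + 1) * ∑' a, peelingBound ψ ρ a) := by
        simp_rw [Finset.sum_add_distrib]
        gcongr
        · exact R.sum_measure_played_le j (by positivity) T
        · exact R.sum_measure_exists_deviates_le hψ hρ hα T
    _ = 4 * ψ * Real.log T / (p i * μ i - p j * μ j) ^ 2 +
        ((1 + (m + 1) * ∑' a, peelingBound ψ ρ a) +
          ∑ t ∈ Finset.range T, Pr.real {ω | B.ErrorOne ψ x t ω}) := by ring
    -- The gap is at most `1`, so the other terms may be divided by its square, too.
    _ ≤ 4 * ψ * Real.log T / (p i * μ i - p j * μ j) ^ 2 +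
        ((1 + (m + 1) * ∑' a, peelingBound ψ ρ a) +
          ∑ t ∈ Finset.range T, Pr.real {ω | B.ErrorOne ψ x t ω}) /
            (p i * μ i - p j * μ j) ^ 2 := by
        gcongr
        exact le_div_self (by positivity) (by positivity) (pow_le_one₀ hg.le hg1)
    _ = _ := by ring

end Counting

/-! ### Decomposition of the regret -/

/-- Telescoping sum over the pairs of consecutive arms between `a` and `b`. -/
theorem sum_consecutive_sub (f : Fin (m + 1) → ℝ) (a b : Fin (m + 1)) (hab : a ≤ b) :
    ∑ i : Fin m, (if i.castSucc < b then
      (if a ≤ i.castSucc then f i.castSucc - f i.succ else 0) else 0) = f a - f b := by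
  induction b using Fin.induction with
  | zero => simp [Fin.le_zero_iff.1 hab]
  | succ c ih =>
    rcases eq_or_lt_of_le hab with rfl | h
    · rw [sub_self]
      refine Finset.sum_eq_zero fun i _ => ?_
      split_ifs with h1 h2
      · exact absurd h2 (not_le.2 h1)
      · rfl
      · rfl
    · have hac : a ≤ c.castSucc := Fin.le_castSucc_iff.2 h
      have key : ∀ i : Fin m, (if i.castSucc < c.succ then
          (if a ≤ i.castSucc then f i.castSucc - f i.succ else 0) else 0) =
          (if i.castSucc < c.castSucc then
          (if a ≤ i.castSucc then f i.castSucc - f i.succ else 0) else 0) +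
          (if i = c then f c.castSucc - f c.succ else 0) := fun i => by
        rcases lt_trichotomy i c with hi | rfl | hi
        · simp [Fin.castSucc_lt_succ_iff, hi.le, hi, hi.ne]
        · simp [hac]
        · simp [Fin.castSucc_lt_succ_iff, not_le.2 hi, hi.not_gt, hi.ne']
      simp_rw [key, Finset.sum_add_distrib, ih hac]
      simp

section Regret

variable {B : SleepingBandit p μ Pr} {ψ : ℝ} {x : ℕ → Ω → Fin (m + 1)}

/-- The event that arm `k` is the active arm of least index in slot `t`. -/
def firstActive (B : SleepingBandit p μ Pr) (k : Fin (m + 1)) (t : ℕ) : Set Ω :=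
  {ω | k ∈ B.active t ω} ∩ ⋂ i ∈ Finset.Iio k, {ω | i ∈ B.active t ω}ᶜ

theorem measurableSet_firstActive (B : SleepingBandit p μ Pr) (k : Fin (m + 1)) (t : ℕ) :
    MeasurableSet[B.hist t] (B.firstActive k t) :=
  (B.active_measurable t k).inter
    (Finset.measurableSet_biInter _ fun i _ => (B.active_measurable t i).compl)

theorem mem_firstActive_iff (B : SleepingBandit p μ Pr) {k : Fin (m + 1)} {t : ℕ} {ω : Ω}
    (h : (B.active t ω).Nonempty) : ω ∈ B.firstActive k t ↔ k = (B.active t ω).min' h := by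
  simp only [firstActive, Set.mem_inter_iff, Set.mem_iInter, Finset.mem_Iio]
  constructor
  · rintro ⟨h1, h2⟩
    exact le_antisymm (not_lt.1 fun hlt => h2 _ hlt (Finset.min'_mem _ h)) (Finset.min'_le _ _ h1)
  · rintro rfl
    exact ⟨Finset.min'_mem _ h, fun i hi hi' => absurd (Finset.min'_le _ i hi') (not_le.2 hi)⟩

/-- A function of the selected arm, as a sum over all arms. -/
theorem sum_firstActive (B : SleepingBandit p μ Pr) (t : ℕ) (ω : Ω) (f : Fin (m + 1) → Ω → ℝ) :
    ∑ k, (B.firstActive k t).indicator (f k) ω =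
      if h : (B.active t ω).Nonempty then f ((B.active t ω).min' h) ω else 0 := by
  split_ifs with h
  · rw [Finset.sum_eq_single ((B.active t ω).min' h)]
    · exact Set.indicator_of_mem ((B.mem_firstActive_iff h).2 rfl) _
    · exact fun k _ hk => Set.indicator_of_notMem (fun h' => hk ((B.mem_firstActive_iff h).1 h')) _
    · simp
  · exact Finset.sum_eq_zero fun k _ => Set.indicator_of_notMem (fun h' => h ⟨k, h'.1⟩) _

theorem sum_played (B : SleepingBandit p μ Pr) (x : ℕ → Ω → Fin (m + 1)) (t : ℕ) (ω : Ω)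
    (f : Fin (m + 1) → Ω → ℝ) :
    ∑ k, (B.played x k t).indicator (f k) ω =
      if x t ω ∈ B.active t ω then f (x t ω) ω else 0 := by
  split_ifs with h
  · rw [Finset.sum_eq_single (x t ω)]
    · exact Set.indicator_of_mem (show ω ∈ B.played x (x t ω) t from ⟨rfl, h⟩) _
    · exact fun k _ hk => Set.indicator_of_notMem (fun h' => hk h'.1.symm) _
    · simp
  · exact Finset.sum_eq_zero fun k _ => Set.indicator_of_notMem
      (fun h' : ω ∈ B.played x k t => h (h'.1 ▸ h'.2)) _

/-- On an event that is known before the rewards of slot `t`, a reward may be replaced by its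
mean. -/
theorem integral_indicator_reward [IsProbabilityMeasure Pr] (B : SleepingBandit p μ Pr) (t : ℕ)
    (k : Fin (m + 1)) {A : Set Ω} (hA : MeasurableSet[B.hist t] A) :
    ∫ ω, A.indicator (B.reward t k) ω ∂Pr = ∫ ω, A.indicator (fun _ => μ k) ω ∂Pr := by
  rw [integral_indicator (B.hist.le t _ hA), integral_indicator (B.hist.le t _ hA),
    ← setIntegral_condExp (B.hist.le t) (B.integrable_reward t k) hA]
  refine integral_congr_ae (ae_restrict_of_ae ?_)
  have h := condExp_indep_eq (B.measurable_reward t k).comap_le (B.hist.le t)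
    (comap_measurable (B.reward t k)).stronglyMeasurable (B.reward_indep t k)
  rwa [B.reward_mean] at h

theorem IsRun.measurableSet_errorTwo (R : B.IsRun ψ x) (t : ℕ) :
    MeasurableSet {ω | B.ErrorTwo x t ω} := by
  have : {ω | B.ErrorTwo x t ω} =
      {ω | x t ω ∈ B.active t ω}ᶜ ∩ ⋃ k, {ω | k ∈ B.active t ω} := by
    ext ω
    simp [ErrorTwo, Finset.Nonempty]
  rw [this]
  exact (B.hist.le t _ (R.measurableSet_mem_active t)).compl.inter
    (MeasurableSet.iUnion fun k => B.hist.le t _ (B.active_measurable t k))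

/-- The loss in mean of one slot. If the optimal arm is `o` and the active arm `j` is played, then
`μ o - μ j` telescopes over the pairs of consecutive arms between `o` and `j`. -/
theorem sum_mean_sub_le [IsProbabilityMeasure Pr] (B : SleepingBandit p μ Pr)
    (x : ℕ → Ω → Fin (m + 1)) (hμ : StrictAnti μ) (t : ℕ) (ω : Ω) :
    ∑ k, (B.firstActive k t).indicator (fun _ => μ k) ω -
        ∑ k, (B.played x k t).indicator (fun _ => μ k) ω ≤
      ∑ j : Fin (m + 1), ∑ i : Fin m, (if i.castSucc < j then
        (B.playedBelow x i.castSucc j t).indicator (fun _ => μ i.castSucc - μ i.succ) ω else 0) +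
      {ω | B.ErrorTwo x t ω}.indicator (fun _ => μ 0) ω := by
  rw [B.sum_firstActive t ω fun k _ => μ k, B.sum_played x t ω fun k _ => μ k]
  have hterm : ∀ (j : Fin (m + 1)) (i : Fin m), 0 ≤ if i.castSucc < j then
      (B.playedBelow x i.castSucc j t).indicator (fun _ => μ i.castSucc - μ i.succ) ω else 0 :=
    fun j i => by
      have := hμ (Fin.castSucc_lt_succ (i := i))
      split_ifs
      · exact Set.indicator_nonneg (fun _ _ => by linarith) _
      · exact le_rfl
  have hE : 0 ≤ {ω | B.ErrorTwo x t ω}.indicator (fun _ => μ 0) ω :=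
    Set.indicator_nonneg (fun _ _ => (B.mean_mem_Icc 0).1) _
  by_cases hne : (B.active t ω).Nonempty
  swap
  · rw [dif_neg hne, if_neg fun h => hne ⟨_, h⟩, sub_zero]
    exact add_nonneg (Finset.sum_nonneg fun j _ => Finset.sum_nonneg fun i _ => hterm j i) hE
  rw [dif_pos hne]
  by_cases hx : x t ω ∈ B.active t ω
  · rw [if_pos hx, ← sum_consecutive_sub μ _ _ (Finset.min'_le _ _ hx)]
    refine le_add_of_le_of_nonneg ?_ hE
    refine le_trans (le_of_eq ?_) (Finset.single_le_sum
      (fun j _ => Finset.sum_nonneg fun i _ => hterm j i) (Finset.mem_univ (x t ω)))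
    refine Finset.sum_congr rfl fun i _ => ?_
    have hiff : ω ∈ B.playedBelow x i.castSucc (x t ω) t ↔
        (B.active t ω).min' hne ≤ i.castSucc :=
      ⟨fun ⟨_, k, hk, hk'⟩ => (Finset.min'_le _ k hk').trans hk,
        fun h => ⟨⟨rfl, hx⟩, _, h, Finset.min'_mem _ hne⟩⟩
    by_cases h : (B.active t ω).min' hne ≤ i.castSucc
    · rw [if_pos h, Set.indicator_of_mem (hiff.2 h)]
    · rw [if_neg h, Set.indicator_of_notMem (mt hiff.1 h)]
  · rw [if_neg hx, sub_zero]
    refine le_add_of_nonneg_of_le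
      (Finset.sum_nonneg fun j _ => Finset.sum_nonneg fun i _ => hterm j i) ?_
    rw [Set.indicator_of_mem (show ω ∈ {ω | B.ErrorTwo x t ω} from ⟨hx, hne⟩)]
    exact hμ.antitone (Fin.zero_le _)

theorem IsRun.regret_le [IsProbabilityMeasure Pr] (R : B.IsRun ψ x) (hμ : StrictAnti μ) (T : ℕ) :
    B.regret x T ≤
      ∑ j : Fin (m + 1), ∑ i : Fin m, (if i.castSucc < j then (μ i.castSucc - μ i.succ) *
        ∑ t ∈ Finset.range T, Pr.real (B.playedBelow x i.castSucc j t) else 0) +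
      μ 0 * ∑ t ∈ Finset.range T, Pr.real {ω | B.ErrorTwo x t ω} := by
  have hF : ∀ k t, MeasurableSet (B.firstActive k t) := fun k t =>
    B.hist.le t _ (B.measurableSet_firstActive k t)
  have hP : ∀ k t, MeasurableSet (B.played x k t) := fun k t =>
    B.hist.le t _ (R.measurableSet_played k t)
  have hG : ∀ i j t, MeasurableSet (B.playedBelow x i j t) := fun i j t =>
    B.hist.le t _ (R.measurableSet_playedBelow i j t)
  have hslot : ∀ t, ∫ ω, (B.optReward t ω - B.gain x t ω) ∂Pr ≤
      ∑ j : Fin (m + 1), ∑ i : Fin m, (if i.castSucc < j then (μ i.castSucc - μ i.succ) *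
        Pr.real (B.playedBelow x i.castSucc j t) else 0) +
      μ 0 * Pr.real {ω | B.ErrorTwo x t ω} := fun t => by
    have hi1 : ∀ k, Integrable ((B.firstActive k t).indicator (B.reward t k)) Pr := fun k =>
      (B.integrable_reward t k).indicator (hF k t)
    have hi2 : ∀ k, Integrable ((B.played x k t).indicator (B.reward t k)) Pr := fun k =>
      (B.integrable_reward t k).indicator (hP k t)
    have hi3 : ∀ k, Integrable ((B.firstActive k t).indicator fun _ => μ k) Pr := fun k =>
      (integrable_const _).indicator (hF k t)
    have hi4 : ∀ k, Integrable ((B.played x k t).indicator fun _ => μ k) Pr := fun k =>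
      (integrable_const _).indicator (hP k t)
    have hi5 : ∀ (j : Fin (m + 1)) (i : Fin m), Integrable (fun ω => if i.castSucc < j then
        (B.playedBelow x i.castSucc j t).indicator (fun _ => μ i.castSucc - μ i.succ) ω
        else 0) Pr := fun j i => by
      split_ifs
      · exact (integrable_const _).indicator (hG _ _ t)
      · exact integrable_const _
    have hi6 : Integrable ({ω | B.ErrorTwo x t ω}.indicator fun _ => μ 0) Pr :=
      (integrable_const _).indicator (R.measurableSet_errorTwo t)
    have hi7 := integrable_finsetSum Finset.univ fun j _ =>
      integrable_finsetSum Finset.univ fun i _ => hi5 j i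
    calc ∫ ω, (B.optReward t ω - B.gain x t ω) ∂Pr
        = ∫ ω, (∑ k, (B.firstActive k t).indicator (B.reward t k) ω -
          ∑ k, (B.played x k t).indicator (B.reward t k) ω) ∂Pr := by
          simp_rw [sum_firstActive, sum_played]
          rfl
      _ = ∫ ω, (∑ k, (B.firstActive k t).indicator (fun _ => μ k) ω -
          ∑ k, (B.played x k t).indicator (fun _ => μ k) ω) ∂Pr := by
          rw [integral_sub (integrable_finsetSum _ fun k _ => hi1 k)
              (integrable_finsetSum _ fun k _ => hi2 k),
            integral_sub (integrable_finsetSum _ fun k _ => hi3 k)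
              (integrable_finsetSum _ fun k _ => hi4 k),
            integral_finsetSum _ fun k _ => hi1 k, integral_finsetSum _ fun k _ => hi2 k,
            integral_finsetSum _ fun k _ => hi3 k, integral_finsetSum _ fun k _ => hi4 k]
          congr 1
          · exact Finset.sum_congr rfl fun k _ =>
              B.integral_indicator_reward t k (B.measurableSet_firstActive k t)
          · exact Finset.sum_congr rfl fun k _ =>
              B.integral_indicator_reward t k (R.measurableSet_played k t)
      _ ≤ _ := integral_mono
          ((integrable_finsetSum _ fun k _ => hi3 k).sub (integrable_finsetSum _ fun k _ => hi4 k))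
          (hi7.add hi6) fun ω => B.sum_mean_sub_le x hμ t ω
      _ = _ := by
          refine (integral_add hi7 hi6).trans ?_
          rw [integral_finsetSum _ fun j _ =>
            integrable_finsetSum Finset.univ fun i _ => hi5 j i,
            integral_indicator_const _ (R.measurableSet_errorTwo t), smul_eq_mul, mul_comm (μ 0)]
          congr 1
          refine Finset.sum_congr rfl fun j _ => ?_
          rw [integral_finsetSum _ fun i _ => hi5 j i]
          refine Finset.sum_congr rfl fun i _ => ?_
          split_ifs
          · rw [integral_indicator_const _ (hG _ _ t), smul_eq_mul, mul_comm]
          · simp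
  have hint : ∀ t, Integrable (fun ω => B.optReward t ω - B.gain x t ω) Pr := fun t => by
    have := (integrable_finsetSum Finset.univ fun k _ =>
      (B.integrable_reward t k).indicator (hF k t)).sub
      (integrable_finsetSum Finset.univ fun k _ => (B.integrable_reward t k).indicator (hP k t))
    refine this.congr (ae_of_all _ fun ω => ?_)
    simp only [Pi.sub_apply, sum_firstActive, sum_played]
    rfl
  rw [regret]
  simp_rw [← Finset.sum_sub_distrib]
  rw [integral_finsetSum _ fun t _ => hint t]
  refine (Finset.sum_le_sum fun t _ => hslot t).trans (le_of_eq ?_)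
  rw [Finset.sum_add_distrib, Finset.mul_sum, Finset.sum_comm]
  congr 1
  refine Finset.sum_congr rfl fun j _ => ?_
  rw [Finset.sum_comm]
  refine Finset.sum_congr rfl fun i _ => ?_
  split_ifs
  · rw [Finset.mul_sum]
  · simp

end Regret

end SleepingBandit

/-! ### The two gap sums -/

theorem pairSum_nonneg {m : ℕ} {p μ : Fin (m + 1) → ℝ} (hμ : StrictAnti μ) : 0 ≤ pairSum p μ :=
  Finset.sum_nonneg fun j _ => Finset.sum_nonneg fun i _ => by
    have := hμ (Fin.castSucc_lt_succ (i := i))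
    split_ifs
    · exact div_nonneg (by linarith) (sq_nonneg _)
    · exact le_rfl

/-- A gap between the arms `i < j` is at least the last consecutive gap, between `j - 1` and `j`;
the differences of consecutive means have sum at most `1`. -/
theorem pairSum_le_gapSum {m : ℕ} {p μ : Fin (m + 1) → ℝ} (hμ : StrictAnti μ)
    (hpμ : StrictAnti fun i => p i * μ i) (h01 : ∀ i, μ i ∈ Set.Icc (0 : ℝ) 1) :
    pairSum p μ ≤ gapSum p μ := by
  have hd : ∀ i : Fin m, 0 ≤ μ i.castSucc - μ i.succ := fun i =>
    sub_nonneg.2 (hμ.antitone (Fin.castSucc_lt_succ (i := i)).le)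
  have hgap0 : 0 ≤ gapSum p μ := Finset.sum_nonneg fun j _ => by positivity
  have hsum : ∑ i : Fin m, (μ i.castSucc - μ i.succ) ≤ 1 := by
    have := SleepingBandit.sum_consecutive_sub μ 0 (Fin.last m) (Fin.zero_le _)
    simp only [Fin.castSucc_lt_last, if_true, Fin.zero_le] at this
    rw [this]
    linarith [(h01 0).2, (h01 (Fin.last m)).1]
  calc pairSum p μ
      ≤ ∑ i : Fin m, (μ i.castSucc - μ i.succ) * gapSum p μ := by
        rw [pairSum, Finset.sum_comm]
        refine Finset.sum_le_sum fun i _ => ?_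
        rw [Fin.sum_univ_succ, if_neg (Fin.not_lt_zero _), zero_add, gapSum, Finset.mul_sum]
        refine Finset.sum_le_sum fun j _ => ?_
        split_ifs with h
        · have hij : i ≤ j := Fin.castSucc_lt_succ_iff.1 h
          have h1 : p j.succ * μ j.succ < p j.castSucc * μ j.castSucc :=
            hpμ (Fin.castSucc_lt_succ (i := j))
          have h2 : p j.castSucc * μ j.castSucc ≤ p i.castSucc * μ i.castSucc :=
            hpμ.antitone (Fin.castSucc_le_castSucc_iff.2 hij)
          rw [div_eq_mul_one_div]
          refine mul_le_mul_of_nonneg_left (one_div_le_one_div_of_le ?_ ?_) (hd i)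
          · exact sq_pos_of_neg (by linarith)
          · nlinarith
        · exact mul_nonneg (hd i) (by positivity)
    _ = (∑ i : Fin m, (μ i.castSucc - μ i.succ)) * gapSum p μ := by rw [Finset.sum_mul]
    _ ≤ gapSum p μ := mul_le_of_le_one_left hgap0 hsum

theorem theorem1 (m : ℕ) (ψ : ℝ) (hψ : 1 / 2 < ψ) (p : Fin (m + 1) → ℝ)
    (hp : ∀ i, 0 < p i ∧ p i ≤ 1) :
    ∃ C : ℝ, ∀ (μ : Fin (m + 1) → ℝ), StrictAnti μ → StrictAnti (fun i => p i * μ i) →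
      ∀ (Ω : Type*) [MeasurableSpace Ω] (Pr : Measure Ω) [IsProbabilityMeasure Pr]
        (B : SleepingBandit p μ Pr) (x : ℕ → Ω → Fin (m + 1)), B.IsRun ψ x →
      ∀ T : ℕ, 1 ≤ T →
        B.regret x T ≤
          (4 * ψ * Real.log (T * avgProb p) + C + B.freqOne ψ x T * T) * pairSum p μ
            + μ 0 * B.freqTwo x T * T ∧
        B.regret x T ≤
          (8 * ψ * Real.log (T * avgProb p) + C + B.freqOne ψ x T * T) * gapSum p μ
            + μ 0 * B.freqTwo x T * T := by
  have hψ0 : 0 < ψ := by linarith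
  obtain ⟨ρ, hρ, hα⟩ := SleepingBandit.exists_peeling_ratio hψ
  obtain ⟨C₀, hC₀⟩ : ∃ C₀, C₀ = 1 + (m + 1) * ∑' a, SleepingBandit.peelingBound ψ ρ a := ⟨_, rfl⟩
  have hC₀0 : 0 ≤ C₀ := by
    have : 0 ≤ ∑' a, SleepingBandit.peelingBound ψ ρ a :=
      tsum_nonneg fun a => SleepingBandit.peelingBound_nonneg ψ ρ a
    rw [hC₀]
    positivity
  have havg : 0 < avgProb p :=
    div_pos (Finset.sum_pos (fun i _ => (hp i).1) Finset.univ_nonempty) (by positivity)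
  -- The second bound contains `8ψ log (avgProb p) ≤ 0`, which the constant has to compensate.
  refine ⟨C₀ + 8 * ψ * |Real.log (avgProb p)|, fun μ hμ hpμ Ω _ Pr _ B x R T hT => ?_⟩
  have hT0 : (0 : ℝ) < T := by exact_mod_cast hT
  have hlogT : 0 ≤ Real.log T := Real.log_natCast_nonneg _
  have hlog : Real.log (T * avgProb p) = Real.log T + Real.log (avgProb p) :=
    Real.log_mul hT0.ne' havg.ne'
  have habs : 0 ≤ ψ * (|Real.log (avgProb p)| + Real.log (avgProb p)) :=
    mul_nonneg hψ0.le (by linarith [neg_abs_le (Real.log (avgProb p))])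
  have habs' : 0 ≤ ψ * |Real.log (avgProb p)| := by positivity
  have hψT : 0 ≤ ψ * Real.log T := by positivity
  have h1 : B.freqOne ψ x T * T = ∑ t ∈ Finset.range T, Pr.real {ω | B.ErrorOne ψ x t ω} :=
    div_mul_cancel₀ _ hT0.ne'
  have h2 : μ 0 * B.freqTwo x T * T =
      μ 0 * ∑ t ∈ Finset.range T, Pr.real {ω | B.ErrorTwo x t ω} := by
    rw [mul_assoc, SleepingBandit.freqTwo, div_mul_cancel₀ _ hT0.ne']
  have hE : 0 ≤ ∑ t ∈ Finset.range T, Pr.real {ω | B.ErrorOne ψ x t ω} :=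
    Finset.sum_nonneg fun _ _ => measureReal_nonneg
  rw [h1, h2, hlog]
  obtain ⟨E, hEE⟩ : ∃ E, E = ∑ t ∈ Finset.range T, Pr.real {ω | B.ErrorOne ψ x t ω} := ⟨_, rfl⟩
  rw [← hEE] at hE ⊢
  have main : B.regret x T ≤ (4 * ψ * Real.log T + C₀ + E) * pairSum p μ +
      μ 0 * ∑ t ∈ Finset.range T, Pr.real {ω | B.ErrorTwo x t ω} := by
    refine (R.regret_le hμ T).trans (add_le_add ?_ le_rfl)
    rw [pairSum, Finset.mul_sum]
    refine Finset.sum_le_sum fun j _ => ?_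
    rw [Finset.mul_sum]
    refine Finset.sum_le_sum fun i _ => ?_
    split_ifs with h
    · have := hμ (Fin.castSucc_lt_succ (i := i))
      rw [mul_div_left_comm, hEE, hC₀]
      exact mul_le_mul_of_nonneg_left
        (R.sum_measure_playedBelow_le hψ0.le hp hμ hpμ hρ hα h T) (by linarith)
    · simp
  have hpair := pairSum_nonneg (p := p) hμ
  constructor
  · refine main.trans (add_le_add (mul_le_mul_of_nonneg_right ?_ hpair) le_rfl)
    nlinarith
  · refine main.trans (add_le_add ?_ le_rfl)
    refine mul_le_mul ?_ (pairSum_le_gapSum hμ hpμ B.mean_mem_Icc) hpair ?_ <;> nlinarith
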